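/- Let $\mathbb F_q$ be a finite field and let $N\ge K\ge 1$. A server has a library of $N$ files $W_1,\dots,W_N$, each consisting of $F$ symbols; all symbols are i.i.d. uniform on $\mathbb F_q$. User $k\in[K]$ has distortion requirement $D_k$, where $1-1/q\ge D_1\ge D_2\ge\dots\ge D_K\ge 0$, and target rate $r_k=\rho(D_k)$, where $\rho(D)=\log_2 q-H(D)-D\log_2(q-1)$ with $H$ the binary entropy function in bits. For file size $F$, a caching scheme with normalized cache sizes $\bm m=(m_1,\dots,m_K)$ and delivery load $R$ consists of numbers $v_{\mathcal T}\ge 0$ ($\emptyset\ne\mathcal T\subseteq[K]$) with $\sum_{\mathcal T}v_{\mathcal T}=R$; placement functions $\varphi_k:(\mathbb F_q^F)^N\to[2^{Nm_kF}]$, giving cache contents $Z_k=\varphi_k(W_1,\dots,W_N)$; for each demand vector $\bm d\in[N]^K$ and each nonempty $\mathcal T\subseteq[K]$ an encoding function $\psi_{\mathcal T,\bm d}:(\mathbb F_q^F)^K\to[2^{v_{\mathcal T}F}]$, giving signals $X_{\mathcal T,\bm d}=\psi_{\mathcal T,\bm d}(W_{d_1},\dots,W_{d_K})$; and for each $\bm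 d$ and $k$ a decoding function giving a reconstruction $\hat W_{d_k}\in\mathbb F_q^F$ of $W_{d_k}=(S_{d_k,1},\dots,S_{d_k,F})$ from $Z_k$ and all the signals $X_{\mathcal T,\bm d}$. Here $[2^b]=\{1,\dots,\lfloor 2^b\rfloor\}$. A load $R$ is achievable for $\bm m$ if there are such schemes, one for every $F$, with $$\limsup_{F\to\infty}\ \mathbb E\Big[\tfrac1F\big|\{i : S_{d_k,i}\ne\hat S_{d_k,i}\}\big|\Big]\le D_k\qquad\text{for all } k\in[K]\text{ and all }\bm d\in[N]^K .$$ Let $R^*(\bm m,\bm r)$ be the infimum of the loads achievable for $\bm m$. For $0\le m_{\text{tot}}\le\sum_{k=1}^K r_k$ let $\mathcal M(m_{\text{tot}},\bm r)=\{\bm m : 0\le m_k\le r_k\ \forall k,\ \sum_{k=1}^K m_k=m_{\text{tot}}\}$ and $R^*(m_{\text{tot}},\bm r)=\inf_{\bm m\in\mathcal M(m_{\text{tot}},\bm r)}R^*(\bm m,\bm r)$. Then the minimum below is attained, and $$R^*(m_{\text{tot}},\bm r)\ \ge\ \min_{\bm m\in\mathcal M(m_{\text{tot}},\bm r)}\ \max_{\emptyset\ne\mathcal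 U\subseteq[K]}\Big\{\sum_{k\in\mathcal U}r_k-\frac{N\sum_{k\in\mathcal U}m_k}{\lfloor N/|\mathcal U|\rfloor}\Big\}.$$ -/

import Mathlib

open Filter

noncomputable section

/-- Rate-distortion function, in bits per sample, of a uniform source over an alphabet of size `q`
under Hamming distortion: `ρ(D) = log₂ q - H₂(D) - D log₂ (q - 1)`.  Here `Real.qaryEntropy q D`
is `D log (q - 1) + H(D)` in nats. -/
def rateDistortion (q : ℕ) (D : ℝ) : ℝ :=
  (Real.log q - Real.qaryEntropy q D) / Real.log 2

/-- The target rate vector `r`, with `r k = ρ(D k)`. -/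
def targetRate (q : ℕ) {K : ℕ} (D : Fin K → ℝ) : Fin K → ℝ :=
  fun k => rateDistortion q (D k)

/-- A file: `F` symbols of the alphabet. -/
abbrev CacheFile (𝔽 : Type*) (F : ℕ) := Fin F → 𝔽

/-- A library of `N` files. -/
abbrev Library (𝔽 : Type*) (N F : ℕ) := Fin N → CacheFile 𝔽 F

/-- The nonempty sets of users. -/
abbrev UserSet (K : ℕ) := {T : Finset (Fin K) // T.Nonempty}

/-- The message set `[2 ^ b]` of messages of (real) length `b` bits, i.e. the integers
`1, …, ⌊2 ^ b⌋`. -/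
abbrev BitMessage (b : ℝ) := Fin ⌊(2 : ℝ) ^ b⌋₊

/-- A caching scheme for `K` users, `N` files of `F` symbols each, cache sizes `m k` normalized by
the library size (the cache of user `k` has `N * m k * F` bits), and delivery load `R`. -/
structure CachingScheme (𝔽 : Type*) (N K F : ℕ) (m : Fin K → ℝ) (R : ℝ) where
  /-- the signal for the set `T` of users has `v T * F` bits -/
  v : UserSet K → ℝ
  v_nonneg : ∀ T, 0 ≤ v T
  sum_v : ∑ T, v T = R
  /-- cache placement, without knowledge of the demands -/
  place : ∀ k : Fin K, Library 𝔽 N F → BitMessage (N * m k * F)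
  /-- encoding of the requested files `(W_{d 1}, …, W_{d K})`, given the demand vector `d` -/
  encode : ∀ (T : UserSet K) (_d : Fin K → Fin N),
    (Fin K → CacheFile 𝔽 F) → BitMessage (v T * F)
  /-- decoding by user `k` from all the signals and the cache of user `k` -/
  decode : ∀ (_d : Fin K → Fin N) (k : Fin K),
    (∀ T : UserSet K, BitMessage (v T * F)) → BitMessage (N * m k * F) → CacheFile 𝔽 F

namespace CachingScheme

variable {𝔽 : Type*} {N K F : ℕ} {m : Fin K → ℝ} {R : ℝ}

/-- The reconstruction by user `k` of the requested file `d k`, when the library is `W`. -/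
def reconstruct (S : CachingScheme 𝔽 N K F m R) (d : Fin K → Fin N) (k : Fin K)
    (W : Library 𝔽 N F) : CacheFile 𝔽 F :=
  S.decode d k (fun T => S.encode T d (fun j => W (d j))) (S.place k W)

/-- The average distortion of user `k` under the demand vector `d`: the expectation, over a
uniformly distributed library (all symbols i.i.d. uniform), of the per-symbol Hamming distortion
between the requested file and its reconstruction. -/
def avgDistortion [Fintype 𝔽] [DecidableEq 𝔽] (S : CachingScheme 𝔽 N K F m R)
    (d : Fin K → Fin N) (k : Fin K) : ℝ :=
  (∑ W : Library 𝔽 N F, (hammingDist (W (d k)) (S.reconstruct d k W) : ℝ) / F) /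
    Fintype.card (Library 𝔽 N F)

end CachingScheme

/-- The delivery load `R` is achievable for the normalized cache sizes `m` and the distortion
requirements `D`: some sequence of schemes, one for each file size `F`, satisfies
`limsup_{F → ∞} (average distortion of user k) ≤ D k` for all demand vectors and all users. -/
def AchievableLoad (𝔽 : Type*) [Fintype 𝔽] [DecidableEq 𝔽] (N : ℕ) {K : ℕ}
    (D m : Fin K → ℝ) (R : ℝ) : Prop :=
  ∃ S : ∀ F : ℕ, CachingScheme 𝔽 N K F m R,
    ∀ (d : Fin K → Fin N) (k : Fin K), ∀ ε > 0,
      ∀ᶠ F in atTop, (S F).avgDistortion d k ≤ D k + ε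

/-- `R*(m, r)`: the infimum (in the extended reals) of the delivery loads that are achievable
with normalized cache sizes `m`. -/
def optLoadFixed (𝔽 : Type*) [Fintype 𝔽] [DecidableEq 𝔽] (N : ℕ) {K : ℕ}
    (D m : Fin K → ℝ) : EReal :=
  ⨅ (R : ℝ) (_ : AchievableLoad 𝔽 N D m R), (R : EReal)

/-- `𝓜(m_tot, r)`: the cache allocations with `0 ≤ m k ≤ r k` and total `m_tot`. -/
def allocations {K : ℕ} (mtot : ℝ) (r : Fin K → ℝ) : Set (Fin K → ℝ) :=
  {m | (∀ k, 0 ≤ m k ∧ m k ≤ r k) ∧ ∑ k, m k = mtot}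

/-- `R*(m_tot, r)`: the infimum of `R*(m, r)` over the cache allocations in `𝓜(m_tot, r)`. -/
def optLoad (𝔽 : Type*) [Fintype 𝔽] [DecidableEq 𝔽] (N : ℕ) {K : ℕ}
    (D : Fin K → ℝ) (mtot : ℝ) : EReal :=
  ⨅ m ∈ allocations mtot (targetRate (Fintype.card 𝔽) D), optLoadFixed 𝔽 N D m

/-- The cut-set expression of a cache allocation `m`: the maximum over the nonempty sets `U` of
users of `∑_{k ∈ U} r k - N ∑_{k ∈ U} m k / ⌊N / |U|⌋` (the division `N / |U|` is in `ℕ`). -/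
def cutSet (N : ℕ) {K : ℕ} (r m : Fin K → ℝ) : ℝ :=
  ⨆ U : UserSet K,
    (∑ k ∈ U.1, r k - N * (∑ k ∈ U.1, m k) / ((N / U.1.card : ℕ) : ℝ))

end

/-! Fix `U` and put `L = ⌊N / |U|⌋`. There are `L` demand vectors under which the users in `U`
request `|U| * L` distinct files in all. Their caches and the `L` transmissions together carry at
most `F * (L * R + N * ∑ k ∈ U, m k)` bits and determine all the reconstructions, so the
rate-distortion converse gives `L * ∑ k ∈ U, r k ≤ L * R + N * ∑ k ∈ U, m k`. Divide by `L`.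

The converse (`sum_log_sub_le_log_card`) avoids mutual information: bounding an exponential moment
of the distances and applying Jensen gives, for any slopes `s`, an inequality linear in the average
distortions. Near-optimal slopes (`exists_slope_qaryEntropy`) turn it into one about entropy.

The minimum is attained by compactness. -/

/-- The moment generating function of the Hamming distance to a fixed word. -/
theorem sum_exp_neg_mul_hammingDist {α : Type*} [Fintype α] [DecidableEq α] {F : ℕ}
    (s : ℝ) (y : Fin F → α) :
    ∑ x : Fin F → α, Real.exp (-(s * hammingDist x y)) =
      (1 + ((Fintype.card α : ℝ) - 1) * Real.exp (-s)) ^ F := by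
  have hletter : ∀ b : α, ∑ a : α, (if a ≠ b then Real.exp (-s) else 1) =
      1 + ((Fintype.card α : ℝ) - 1) * Real.exp (-s) := by
    intro b
    rw [← Finset.add_sum_erase _ _ (Finset.mem_univ b),
      Finset.sum_congr rfl (g := fun _ => Real.exp (-s))
        (fun a ha => if_pos (Finset.ne_of_mem_erase ha))]
    have : 1 ≤ Fintype.card α := Fintype.card_pos_iff.2 ⟨b⟩
    simp [Finset.card_erase_of_mem, Nat.cast_sub this]
  have hword : ∀ x : Fin F → α, Real.exp (-(s * hammingDist x y)) =
      ∏ t, (if x t ≠ y t then Real.exp (-s) else 1) := by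
    intro x
    rw [Finset.prod_ite, Finset.prod_const, Finset.prod_const_one, mul_one, hammingDist,
      ← Real.exp_nat_mul]
    congr 1
    ring
  simp_rw [hword]
  rw [← Fintype.prod_sum (fun (t : Fin F) (a : α) => if a ≠ y t then Real.exp (-s) else 1)]
  simp_rw [hletter]
  simp

/-- A source coding converse: a description of a family of uniform words from which the words are
reconstructed with small average Hamming distance takes many values. -/
theorem sum_log_sub_le_log_card {ι α A : Type*} [Fintype ι] [DecidableEq ι] [Fintype α]
    [DecidableEq α] [Nonempty α] [Fintype A] {F : ℕ} (a : (ι → Fin F → α) → A)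
    (g : A → ι → Fin F → α) (s : ι → ℝ) :
    ∑ n, (F * (Real.log (Fintype.card α) -
          Real.log (1 + ((Fintype.card α : ℝ) - 1) * Real.exp (-s n))) -
        s n * ((∑ W, (hammingDist (W n) (g (a W) n) : ℝ)) / Fintype.card (ι → Fin F → α))) ≤
      Real.log (Fintype.card A) := by
  classical
  set q : ℝ := (Fintype.card α : ℝ) with hq
  have hq1 : 1 ≤ q := by
    rw [hq]
    exact_mod_cast (Fintype.card_pos : 0 < Fintype.card α)
  set P : ℝ := (Fintype.card (ι → Fin F → α) : ℝ) with hP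
  have hP0 : 0 < P := by
    rw [hP]
    exact_mod_cast Fintype.card_pos
  have hPprod : P = ∏ _n : ι, q ^ F := by simp [hP, hq]
  have hz : ∀ n, 0 < 1 + (q - 1) * Real.exp (-s n) := fun n => by
    have := mul_nonneg (sub_nonneg.2 hq1) (Real.exp_pos (-s n)).le
    linarith
  let X : (ι → Fin F → α) → A → ℝ := fun W c => ∑ n, -(s n * hammingDist (W n) (g c n))
  have hA : 0 < (Fintype.card A : ℝ) := by
    have : Nonempty A := ⟨a (Classical.arbitrary _)⟩
    exact_mod_cast Fintype.card_pos
  have hjensen : Real.exp (∑ W, P⁻¹ * X W (a W)) ≤ ∑ W, P⁻¹ * Real.exp (X W (a W)) := by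
    have h := convexOn_exp.map_sum_le (t := (Finset.univ : Finset (ι → Fin F → α)))
      (w := fun _ => P⁻¹) (p := fun W => X W (a W)) (fun _ _ => by positivity)
      (by simp only [Finset.sum_const, Finset.card_univ, nsmul_eq_mul, ← hP]
          exact mul_inv_cancel₀ hP0.ne') (fun _ _ => Set.mem_univ _)
    simpa only [smul_eq_mul] using h
  -- Replacing the message `a W` by a sum over all messages makes the sum over `W` factor over the
  -- files.
  have hcode : ∑ W, Real.exp (X W (a W)) ≤
      Fintype.card A * ∏ n, (1 + (q - 1) * Real.exp (-s n)) ^ F := by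
    calc ∑ W, Real.exp (X W (a W)) ≤ ∑ W, ∑ c, Real.exp (X W c) :=
          Finset.sum_le_sum fun W _ => Finset.single_le_sum (f := fun c => Real.exp (X W c))
            (fun c _ => (Real.exp_pos _).le) (Finset.mem_univ (a W))
      _ = ∑ c, ∑ W, Real.exp (X W c) := Finset.sum_comm
      _ = ∑ _c : A, ∏ n, (1 + (q - 1) * Real.exp (-s n)) ^ F := by
          refine Finset.sum_congr rfl fun c _ => ?_
          simp only [X, Real.exp_sum]
          rw [← Fintype.prod_sum (fun n (x : Fin F → α) =>
            Real.exp (-(s n * hammingDist x (g c n))))]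
          simp_rw [sum_exp_neg_mul_hammingDist]
          rfl
      _ = _ := by simp
  have hlog : ∑ W, P⁻¹ * X W (a W) ≤ Real.log (P⁻¹ *
      (Fintype.card A * ∏ n, (1 + (q - 1) * Real.exp (-s n)) ^ F)) := by
    rw [Real.le_log_iff_exp_le
      (mul_pos (inv_pos.2 hP0) (mul_pos hA (Finset.prod_pos fun n _ => pow_pos (hz n) F)))]
    refine hjensen.trans ?_
    rw [← Finset.mul_sum]
    gcongr
  have hprod : (0 : ℝ) < ∏ n, (1 + (q - 1) * Real.exp (-s n)) ^ F :=
    Finset.prod_pos fun n _ => pow_pos (hz n) F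
  rw [Real.log_mul (inv_pos.2 hP0).ne' (mul_pos hA hprod).ne', Real.log_mul hA.ne' hprod.ne',
    Real.log_inv, hPprod, Real.log_prod (fun _ _ => (by positivity)),
    Real.log_prod (fun n _ => (pow_pos (hz n) F).ne')] at hlog
  simp only [Real.log_pow] at hlog
  rw [← hPprod] at hlog
  have hX : ∑ W, P⁻¹ * X W (a W) =
      -∑ n, s n * ((∑ W, (hammingDist (W n) (g (a W) n) : ℝ)) / P) := by
    simp only [X, Finset.mul_sum, Finset.sum_div]
    rw [Finset.sum_comm, ← Finset.sum_neg_distrib]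
    refine Finset.sum_congr rfl fun n _ => ?_
    rw [← Finset.sum_neg_distrib]
    refine Finset.sum_congr rfl fun W _ => ?_
    ring
  rw [hX] at hlog
  simp only [Finset.sum_sub_distrib, mul_sub] at hlog ⊢
  linarith

/-- The `q`-ary entropy as a Legendre transform: the upper bound by near-optimal slopes. -/
theorem exists_slope_qaryEntropy {q : ℕ} (hq : 2 ≤ q) {D : ℝ} (hD0 : 0 ≤ D)
    (hD1 : D ≤ 1 - 1 / (q : ℝ)) {η : ℝ} (hη : 0 < η) :
    ∃ s : ℝ, 0 ≤ s ∧
      Real.log (1 + ((q : ℝ) - 1) * Real.exp (-s)) + s * D ≤ Real.qaryEntropy q D + η := by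
  have hq' : (2 : ℝ) ≤ q := by exact_mod_cast hq
  rcases hD0.eq_or_lt with rfl | hD
  -- At `D = 0` the optimal slope is infinite; a large finite one costs at most `η`.
  · refine ⟨q / η, by positivity, ?_⟩
    have hpos : 0 < 1 + ((q : ℝ) - 1) * Real.exp (-(q / η)) := by
      have := mul_pos (show (0 : ℝ) < q - 1 by linarith) (Real.exp_pos (-(q / η)))
      linarith
    have hexp : Real.exp (-(q / η)) ≤ η / q := by
      rw [Real.exp_neg, ← inv_div (q : ℝ) η]
      exact inv_anti₀ (by positivity) (by linarith [Real.add_one_le_exp ((q : ℝ) / η)])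
    have hmul : ((q : ℝ) - 1) * Real.exp (-(q / η)) ≤ η := by
      calc ((q : ℝ) - 1) * Real.exp (-(q / η)) ≤ q * (η / q) :=
            mul_le_mul (by linarith) hexp (Real.exp_pos _).le (by linarith)
        _ = η := by field_simp
    have := Real.log_le_sub_one_of_pos hpos
    simp only [mul_zero, add_zero, Real.qaryEntropy_zero, zero_add]
    linarith
  · have hD' : 0 < 1 - D := by
      have : 0 < 1 / (q : ℝ) := by positivity
      linarith
    have hq1 : (0 : ℝ) < q - 1 := by linarith
    -- The slope is the derivative of the entropy at `D`, nonnegative because `D ≤ 1 - 1 / q`; it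
    -- attains the Legendre transform exactly.
    refine ⟨Real.log (((q : ℝ) - 1) * (1 - D) / D), Real.log_nonneg ?_, ?_⟩
    · rw [le_div_iff₀ hD]
      have : (q : ℝ) * D ≤ q - 1 := by
        calc (q : ℝ) * D ≤ q * (1 - 1 / q) := by gcongr
          _ = q - 1 := by field_simp
      linarith
    · have hz : 1 + ((q : ℝ) - 1) * Real.exp (-Real.log (((q : ℝ) - 1) * (1 - D) / D)) =
          (1 - D)⁻¹ := by
        rw [Real.exp_neg, Real.exp_log (by positivity)]
        field_simp
        ring
      rw [hz, Real.log_div (by positivity) hD.ne', Real.log_mul hq1.ne' hD'.ne']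
      simp only [Real.qaryEntropy, Real.binEntropy, Real.log_inv]
      push_cast
      linarith

/-- The entropy increases on `[0, 1 - 1 / q]` to its value `log q` at the right end. -/
theorem rateDistortion_nonneg {q : ℕ} (hq : 2 ≤ q) {D : ℝ} (hD0 : 0 ≤ D)
    (hD1 : D ≤ 1 - 1 / (q : ℝ)) : 0 ≤ rateDistortion q D := by
  refine div_nonneg (sub_nonneg.2 ?_) (Real.log_nonneg one_le_two)
  have hq' : (2 : ℝ) ≤ q := by exact_mod_cast hq
  have hq1 : (0 : ℝ) < q - 1 := by linarith
  calc Real.qaryEntropy q D ≤ Real.qaryEntropy q (1 - 1 / (q : ℝ)) :=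
        (Real.qaryEntropy_strictMonoOn hq).monotoneOn ⟨hD0, hD1⟩
          ⟨hD0.trans hD1, le_rfl⟩ hD1
    _ = Real.log q := by
        have h : 1 - 1 / (q : ℝ) = ((q : ℝ) - 1) / q := by field_simp
        simp only [Real.qaryEntropy, Real.binEntropy, Real.log_inv, sub_sub_cancel]
        rw [h, Real.log_div hq1.ne' (by positivity), Real.log_div one_ne_zero (by positivity)]
        push_cast
        field_simp
        simp only [Real.log_one]
        ring

theorem log_card_bitMessage_le {b : ℝ} (hb : 0 ≤ b) :
    Real.log (Fintype.card (BitMessage b)) ≤ b * Real.log 2 := by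
  rw [Fintype.card_fin, ← Real.log_rpow two_pos]
  refine Real.log_le_log ?_ (Nat.floor_le (by positivity))
  exact_mod_cast Nat.floor_pos.2 (Real.one_le_rpow one_le_two hb)

theorem card_bitMessage_ne_zero {b : ℝ} (hb : 0 ≤ b) :
    (Fintype.card (BitMessage b) : ℝ) ≠ 0 := by
  rw [Fintype.card_fin]
  exact_mod_cast (Nat.floor_pos.2 (Real.one_le_rpow one_le_two hb)).ne'

theorem continuous_cutSet (N : ℕ) {K : ℕ} (hK : 1 ≤ K) (r : Fin K → ℝ) :
    Continuous (cutSet N r) := by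
  have : Nonempty (UserSet K) := ⟨⟨{⟨0, hK⟩}, Finset.singleton_nonempty _⟩⟩
  unfold cutSet
  simp_rw [← Finset.sup'_univ_eq_ciSup]
  refine Continuous.finset_sup'_apply _ fun U _ => ?_
  fun_prop

theorem isCompact_allocations {K : ℕ} (mtot : ℝ) (r : Fin K → ℝ) :
    IsCompact (allocations mtot r) := by
  have h : allocations mtot r = Set.Icc 0 r ∩ {m | ∑ k, m k = mtot} := by
    ext m
    simp [allocations, Pi.le_def, forall_and]
  rw [h]
  exact isCompact_Icc.inter_right (isClosed_eq (by fun_prop) continuous_const)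

theorem allocations_nonempty {K : ℕ} {mtot : ℝ} {r : Fin K → ℝ} (hr : ∀ k, 0 ≤ r k)
    (h0 : 0 ≤ mtot) (h1 : mtot ≤ ∑ k, r k) : (allocations mtot r).Nonempty := by
  rcases (Finset.sum_nonneg fun k _ => hr k : 0 ≤ ∑ k, r k).eq_or_lt with h | h
  · exact ⟨r, fun k => ⟨hr k, le_rfl⟩, by linarith⟩
  · refine ⟨fun k => mtot / (∑ k, r k) * r k, fun k => ⟨?_, ?_⟩, ?_⟩
    · exact mul_nonneg (by positivity) (hr k)
    · exact mul_le_of_le_one_left (hr k) ((div_le_one h).2 h1)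
    · rw [← Finset.mul_sum, div_mul_cancel₀ _ h.ne']


/-- The cut-set converse at a fixed file size: the caches of the users in `U` and the signals for
the demands `d 0, …, d (L - 1)` describe all the files that these users request. -/
theorem CachingScheme.sum_le_of_injective {𝔽 : Type*} [Fintype 𝔽] [DecidableEq 𝔽] [Nonempty 𝔽]
    {N K F L : ℕ} {m : Fin K → ℝ} {R : ℝ} (S : CachingScheme 𝔽 N K F m R) (hF : 0 < F)
    (hm : ∀ k, 0 ≤ m k) (U : Finset (Fin K)) (d : Fin L → Fin K → Fin N)
    (hd : Function.Injective fun i : U × Fin L => d i.2 i.1) (s : U × Fin L → ℝ) :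
    ∑ i : U × Fin L, (Real.log (Fintype.card 𝔽) -
          Real.log (1 + ((Fintype.card 𝔽 : ℝ) - 1) * Real.exp (-s i)) -
        s i * S.avgDistortion (d i.2) i.1) ≤
      Real.log 2 * (L * R + N * ∑ k ∈ U, m k) := by
  classical
  have hF' : (0 : ℝ) < F := by exact_mod_cast hF
  set e : U × Fin L → Fin N := fun i => d i.2 i.1 with he
  let A := (Fin L → ∀ T : UserSet K, BitMessage (S.v T * F)) ×
    (∀ k : U, BitMessage (N * m k * F))
  let a : Library 𝔽 N F → A := fun W =>
    (fun l T => S.encode T (d l) fun j => W (d l j), fun k => S.place k W)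
  let g : A → Library 𝔽 N F := fun c => Function.extend e
    (fun i => S.decode (d i.2) i.1 (c.1 i.2) (c.2 i.1)) fun _ _ => Classical.arbitrary 𝔽
  have hg : ∀ W i, g (a W) (e i) = S.reconstruct (d i.2) i.1 W := fun W i =>
    hd.extend_apply _ _ i
  have hv : ∀ T, 0 ≤ S.v T * F := fun T => mul_nonneg (S.v_nonneg T) hF'.le
  have hmF : ∀ k, 0 ≤ N * m k * F := fun k =>
    mul_nonneg (mul_nonneg N.cast_nonneg (hm k)) hF'.le
  have hcard : Real.log (Fintype.card A) ≤ F * (Real.log 2 * (L * R + N * ∑ k ∈ U, m k)) := by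
    simp only [A, Fintype.card_prod, Fintype.card_pi, Nat.cast_mul, Nat.cast_prod,
      Finset.prod_const, Finset.card_univ, Fintype.card_fin L, Nat.cast_pow]
    have h1 : ∀ T, (Fintype.card (BitMessage (S.v T * F)) : ℝ) ≠ 0 := fun T =>
      card_bitMessage_ne_zero (hv T)
    have h2 : ∀ k : U, (Fintype.card (BitMessage (N * m k * F)) : ℝ) ≠ 0 := fun k =>
      card_bitMessage_ne_zero (hmF k)
    rw [Real.log_mul (pow_ne_zero _ (Finset.prod_ne_zero_iff.2 fun T _ => h1 T))
      (Finset.prod_ne_zero_iff.2 fun k _ => h2 k), Real.log_pow,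
      Real.log_prod (fun T _ => h1 T), Real.log_prod (fun k _ => h2 k)]
    calc L * ∑ T, Real.log (Fintype.card (BitMessage (S.v T * F))) +
          ∑ k : U, Real.log (Fintype.card (BitMessage (N * m k * F)))
        ≤ L * ∑ T, S.v T * F * Real.log 2 + ∑ k : U, N * m k * F * Real.log 2 := by
          gcongr with T _ k _
          · exact log_card_bitMessage_le (hv T)
          · exact log_card_bitMessage_le (hmF k)
      _ = F * (Real.log 2 * (L * R + N * ∑ k ∈ U, m k)) := by
          rw [← Finset.sum_coe_sort U, ← Finset.sum_mul, ← Finset.sum_mul,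
            ← Finset.sum_mul, ← Finset.sum_mul, ← Finset.mul_sum, S.sum_v]
          ring
  -- Files that are not requested get slope `0`, so their terms vanish whatever their
  -- reconstruction.
  have hmain := (sum_log_sub_le_log_card a g (Function.extend e s 0)).trans hcard
  rw [← Fintype.sum_of_injective e hd (fun i => F * (Real.log (Fintype.card 𝔽) -
          Real.log (1 + ((Fintype.card 𝔽 : ℝ) - 1) * Real.exp (-s i)) -
        s i * S.avgDistortion (d i.2) i.1)) _ ?_ ?_, ← Finset.mul_sum] at hmain
  · exact le_of_mul_le_mul_left hmain hF'
  · intro n hn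
    rw [Function.extend_apply' _ _ _ (by simpa using hn)]
    simp
  · intro i
    rw [hd.extend_apply]
    simp only [hg, CachingScheme.avgDistortion, ← Finset.sum_div]
    simp only [he]
    field_simp

/-- There are `⌊N / |U|⌋` demand vectors for which the users in `U` request distinct files. -/
theorem exists_demands_injective {N K : ℕ} (U : Finset (Fin K)) (hU : U.Nonempty) :
    ∃ d : Fin (N / U.card) → Fin K → Fin N,
      Function.Injective fun i : U × Fin (N / U.card) => d i.2 i.1 := by
  classical
  obtain ⟨u, hu⟩ := hU
  let e : U × Fin (N / U.card) ↪ Fin N :=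
    ((U.equivFin.prodCongr (Equiv.refl _)).trans finProdFinEquiv).toEmbedding.trans
      (Fin.castLEEmb (Nat.mul_div_le N U.card))
  -- Demands outside `U` are irrelevant; they copy that of `u`.
  refine ⟨fun l k => if h : k ∈ U then e (⟨k, h⟩, l) else e (⟨u, hu⟩, l), ?_⟩
  convert e.injective with i
  simp

/-- The cut-set bound for an achievable load. -/
theorem AchievableLoad.sum_targetRate_sub_le {𝔽 : Type*} [Fintype 𝔽] [DecidableEq 𝔽]
    [Nontrivial 𝔽] {N K : ℕ} (hNK : K ≤ N) {D m : Fin K → ℝ} {R : ℝ}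
    (hD0 : ∀ k, 0 ≤ D k) (hD1 : ∀ k, D k ≤ 1 - 1 / (Fintype.card 𝔽 : ℝ)) (hm : ∀ k, 0 ≤ m k)
    (hR : AchievableLoad 𝔽 N D m R) (U : Finset (Fin K)) (hU : U.Nonempty) :
    ∑ k ∈ U, targetRate (Fintype.card 𝔽) D k -
      N * (∑ k ∈ U, m k) / ((N / U.card : ℕ) : ℝ) ≤ R := by
  obtain ⟨S, hS⟩ := hR
  set q := Fintype.card 𝔽
  have hq2 : 2 ≤ q := Fintype.one_lt_card
  have hUN : U.card ≤ N := (card_finset_fin_le U).trans hNK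
  obtain ⟨L, hL⟩ : ∃ L, N / U.card = L := ⟨_, rfl⟩
  have hL0 : (0 : ℝ) < L := by
    rw [← hL]
    exact_mod_cast Nat.div_pos hUN hU.card_pos
  have hdem := exists_demands_injective (N := N) U hU
  rw [hL] at hdem ⊢
  obtain ⟨d, hd⟩ := hdem
  have hlog2 : 0 < Real.log 2 := Real.log_pos one_lt_two
  have key : ∑ i : U × Fin L, (Real.log q - Real.qaryEntropy q (D i.1)) ≤
      Real.log 2 * (L * R + N * ∑ k ∈ U, m k) := by
    refine le_of_forall_pos_le_add fun δ hδ => ?_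
    set n : ℝ := (Fintype.card (U × Fin L) : ℝ) with hn
    have hη : 0 < δ / 2 / (n + 1) := by positivity
    choose s hs0 hs using fun i : U × Fin L =>
      exists_slope_qaryEntropy hq2 (hD0 i.1) (hD1 i.1) hη
    have hs_sum : 0 ≤ ∑ i, s i := Finset.sum_nonneg fun i _ => hs0 i
    -- The slopes are fixed first, so that the excess distortion `ε`, weighted by them, costs at
    -- most `δ / 2`.
    set ε := δ / 2 / (∑ i, s i + 1) with hε
    have hε0 : 0 < ε := by positivity
    -- The finite-length bound has no error term in `F`, so one good `F` suffices.
    obtain ⟨F, hFd, hF⟩ := ((eventually_all.2 fun i : U × Fin L =>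
      hS (d i.2) i.1 ε hε0).and (eventually_gt_atTop 0)).exists
    have hconv := (S F).sum_le_of_injective hF hm U d hd s
    have hterm : ∑ i : U × Fin L, (Real.log q - Real.qaryEntropy q (D i.1)) ≤
        ∑ i : U × Fin L, ((Real.log q - Real.log (1 + ((q : ℝ) - 1) * Real.exp (-s i)) -
          s i * (S F).avgDistortion (d i.2) i.1) + (δ / 2 / (n + 1) + s i * ε)) := by
      refine Finset.sum_le_sum fun i _ => ?_
      have h1 := mul_le_mul_of_nonneg_left (hFd i) (hs0 i)
      have h2 := hs i
      linarith
    rw [Finset.sum_add_distrib, Finset.sum_add_distrib, ← Finset.sum_mul, Finset.sum_const,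
      Finset.card_univ, nsmul_eq_mul, ← hn] at hterm
    have h1 : n * (δ / 2 / (n + 1)) ≤ δ / 2 := by
      rw [mul_div_assoc', div_le_iff₀ (by positivity)]
      linarith
    have h2 : (∑ i, s i) * ε ≤ δ / 2 := by
      rw [hε, mul_div_assoc', div_le_iff₀ (by positivity)]
      linarith
    linarith
  have hsum : ∑ i : U × Fin L, (Real.log q - Real.qaryEntropy q (D i.1)) =
      Real.log 2 * (L * ∑ k ∈ U, targetRate q D k) := by
    rw [Fintype.sum_prod_type, ← Finset.sum_coe_sort U]
    simp only [Finset.sum_const, Finset.card_univ, Fintype.card_fin, nsmul_eq_mul, targetRate,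
      rateDistortion, Finset.mul_sum]
    refine Finset.sum_congr rfl fun k _ => ?_
    field_simp
  rw [hsum] at key
  have := le_of_mul_le_mul_left key hlog2
  rw [sub_le_iff_le_add, ← sub_le_iff_le_add', le_div_iff₀ hL0]
  linarith


/-- The minimum of the cut-set expression over the cache allocations exists, and it is a lower
bound on `R*(m_tot, r)`. -/
theorem proposition1 (𝔽 : Type*) [Field 𝔽] [Fintype 𝔽] [DecidableEq 𝔽]
    (N K : ℕ) (hK : 1 ≤ K) (hNK : K ≤ N)
    (D : Fin K → ℝ) (hD : Antitone D)
    (hD0 : ∀ k, 0 ≤ D k) (hD1 : ∀ k, D k ≤ 1 - 1 / (Fintype.card 𝔽 : ℝ))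
    (mtot : ℝ) (hm0 : 0 ≤ mtot)
    (hm1 : mtot ≤ ∑ k, targetRate (Fintype.card 𝔽) D k) :
    ∃ b : ℝ,
      IsLeast ((fun m => cutSet N (targetRate (Fintype.card 𝔽) D) m) ''
        allocations mtot (targetRate (Fintype.card 𝔽) D)) b ∧
      (b : EReal) ≤ optLoad 𝔽 N D mtot := by

  have hq : 2 ≤ Fintype.card 𝔽 := Fintype.one_lt_card
  set r := targetRate (Fintype.card 𝔽) D
  have hr0 : ∀ k, 0 ≤ r k := fun k => rateDistortion_nonneg hq (hD0 k) (hD1 k)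
  obtain ⟨m, hm, hmin⟩ := (isCompact_allocations mtot r).exists_isMinOn
    (allocations_nonempty hr0 hm0 hm1) (continuous_cutSet N hK r).continuousOn
  refine ⟨cutSet N r m, ⟨⟨m, hm, rfl⟩, ?_⟩, ?_⟩
  · rintro _ ⟨m', hm', rfl⟩
    exact hmin hm'
  · refine le_iInf₂ fun m' hm' => le_iInf₂ fun R hR => EReal.coe_le_coe_iff.2 ?_
    have : Nonempty (UserSet K) := ⟨⟨{⟨0, hK⟩}, Finset.singleton_nonempty _⟩⟩
    exact (hmin hm').trans (ciSup_le fun U : UserSet K =>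
      hR.sum_targetRate_sub_le hNK hD0 hD1 (fun k => (hm'.1 k).1) U.1 U.2)
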